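/- Let $N\ge 0$, let $\mathbb K$ be $\mathbb R$ or $\mathbb C$ and let $\epsilon\in\{1,-1\}$. Let $\mathcal A$ be the unital associative $\mathbb K$-algebra generated by $x_1,\dots,x_N,p_1,\dots,p_N$ subject to $[x_i,x_j]=0$, $[p_i,p_j]=0$, $\big[\tfrac12\sum_{i=1}^N p_i^2,x_j\big]=p_j$ and $\big[\tfrac12\sum_{i=1}^N x_i^2,p_j\big]=-x_j$ for all $i,j$. Let $\mathcal C$ be the Clifford algebra over $\mathbb K$ with generators $e_1,\dots,e_N$ satisfying $e_ie_j+e_je_i=2\epsilon\delta_{ij}$. Work in $\mathcal A\otimes\mathcal C$ (so the $e_i$ commute with the $x_j$ and $p_j$), and put $\underline D=\sum_{i=1}^N e_ip_i$ and $\underline x_S=\sum_{a\in S}x_ae_a$ for $S\subset\{1,\dots,N\}$. A list is a finite sequence $A=a_1\cdots a_n$ of distinct elements of $\{1,\dots,N\}$, and $e_A=e_{a_1}\cdots e_{a_n}$ (with $e_\emptyset=1$). For lists $A_1,\dots,A_k$, with $S=A_1\triangle\cdots\triangle A_k$ the symmetric difference of the underlying sets and $e=e_{A_1}\cdots e_{A_k}$,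 put $$O_{A_1,\dots,A_k}=\tfrac12\big(\underline D\,\underline x_S\,e-e\,\underline x_S\,\underline D-\epsilon e\big).$$ For two such operators $O_{\mathbf A},O_{\mathbf B}$, indexed by sequences of lists $\mathbf A,\mathbf B$ whose symmetric differences are the sets $S,T$, put $$\llbracket O_{\mathbf A},O_{\mathbf B}\rrbracket_{\pm}=O_{\mathbf A}O_{\mathbf B}\pm(-1)^{|S||T|-|S\cap T|}O_{\mathbf B}O_{\mathbf A}.$$ For two lists $A,B$, when used as an index, $A\cap B$ is the list of the elements common to $A$ and $B$, in the order of $A$; in the ranges of sums lists are viewed as sets. Then, for all lists $A$ and $B$, $$\begin{aligned}\llbracket O_A,O_B\rrbracket_+={}&\epsilon\,O_{A,B}+(e_{A\cap B})^2\,2\,O_{A,(A\cap B)}O_{(A\cap B),B}+(e_{A\cap B})^2\,2\,O_{A\cap B}O_{(A\cap B),A,B}\\&-\epsilon\,(e_{A\cap B})^2\sum_{a\in A\setminus B}\llbracket O_a,O_{a,A,(A\cap B),(A\cap B),B}\rrbracket_-\\&-\epsilon\,(e_{A\cap B})^2\sum_{a\in A\cap B}\llbracket O_a,O_{a,(A\cap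 B),(A\cap B),A,B}\rrbracket_-.\end{aligned}$$ -/

import Mathlib

open scoped TensorProduct

noncomputable section

namespace DiracSymm

/-- The generator `x_i` of the free algebra on `x₁, …, x_N` (`Sum.inl`) and `p₁, …, p_N` (`Sum.inr`). -/
def freeX (𝕜 : Type*) [RCLike 𝕜] {N : ℕ} (i : Fin N) : FreeAlgebra 𝕜 (Fin N ⊕ Fin N) :=
  FreeAlgebra.ι 𝕜 (Sum.inl i)

/-- The generator `p_i` of the free algebra. -/
def freeP (𝕜 : Type*) [RCLike 𝕜] {N : ℕ} (i : Fin N) : FreeAlgebra 𝕜 (Fin N ⊕ Fin N) :=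
  FreeAlgebra.ι 𝕜 (Sum.inr i)

/-- The commutator `ab - ba`. -/
def comm {R : Type*} [Ring R] (a b : R) : R := a * b - b * a

/-- The defining relations of the algebra `𝒜`. -/
inductive Rel (𝕜 : Type*) [RCLike 𝕜] (N : ℕ) :
    FreeAlgebra 𝕜 (Fin N ⊕ Fin N) → FreeAlgebra 𝕜 (Fin N ⊕ Fin N) → Prop
  | xx (i j : Fin N) : Rel 𝕜 N (comm (freeX 𝕜 i) (freeX 𝕜 j)) 0
  | pp (i j : Fin N) : Rel 𝕜 N (comm (freeP 𝕜 i) (freeP 𝕜 j)) 0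
  | px (j : Fin N) :
      Rel 𝕜 N (comm ((1 / 2 : 𝕜) • ∑ i : Fin N, freeP 𝕜 i ^ 2) (freeX 𝕜 j)) (freeP 𝕜 j)
  | xp (j : Fin N) :
      Rel 𝕜 N (comm ((1 / 2 : 𝕜) • ∑ i : Fin N, freeX 𝕜 i ^ 2) (freeP 𝕜 j)) (-freeX 𝕜 j)

/-- The unital associative `𝕜`-algebra `𝒜` generated by `x₁, …, x_N, p₁, …, p_N` subject to `Rel`. -/
abbrev AlgA (𝕜 : Type*) [RCLike 𝕜] (N : ℕ) : Type _ := RingQuot (Rel 𝕜 N)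

/-- The quadratic form `v ↦ ε ∑ i, v i ^ 2` on `𝕜 ^ N`. -/
abbrev cliffForm {𝕜 : Type*} [RCLike 𝕜] (N : ℕ) (ε : 𝕜) : QuadraticForm 𝕜 (Fin N → 𝕜) :=
  QuadraticMap.weightedSumSquares 𝕜 (fun _ : Fin N => ε)

/-- The Clifford algebra `𝒞`, with generators satisfying `e_i e_j + e_j e_i = 2 ε δ_ij`. -/
abbrev AlgC {𝕜 : Type*} [RCLike 𝕜] (N : ℕ) (ε : 𝕜) : Type _ := CliffordAlgebra (cliffForm N ε)

/-- The algebra `𝒜 ⊗ 𝒞`. -/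
abbrev AlgAC {𝕜 : Type*} [RCLike 𝕜] (N : ℕ) (ε : 𝕜) : Type _ := AlgA 𝕜 N ⊗[𝕜] AlgC N ε

section

variable {𝕜 : Type*} [RCLike 𝕜] {N : ℕ} (ε : 𝕜)

/-- The element `x_i` of `𝒜 ⊗ 𝒞`. -/
def x (i : Fin N) : AlgAC N ε := RingQuot.mkAlgHom 𝕜 (Rel 𝕜 N) (freeX 𝕜 i) ⊗ₜ[𝕜] 1

/-- The element `p_i` of `𝒜 ⊗ 𝒞`. -/
def p (i : Fin N) : AlgAC N ε := RingQuot.mkAlgHom 𝕜 (Rel 𝕜 N) (freeP 𝕜 i) ⊗ₜ[𝕜] 1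

/-- The element `e_i` of `𝒜 ⊗ 𝒞`. -/
def e (i : Fin N) : AlgAC N ε := 1 ⊗ₜ[𝕜] CliffordAlgebra.ι (cliffForm N ε) (Pi.single i 1)

/-- The Dirac operator `D = ∑ i, e_i p_i`. -/
def dirac : AlgAC N ε := ∑ i, e ε i * p ε i

/-- `x_S = ∑ a ∈ S, x_a e_a` for a subset `S` of the indices. -/
def xVec (S : Finset (Fin N)) : AlgAC N ε := ∑ a ∈ S, x ε a * e ε a

/-- `e_A = e_{a₁} ⋯ e_{aₙ}` for a list `A = a₁ … aₙ`. -/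
def eList (A : List (Fin N)) : AlgAC N ε := (A.map (e ε)).prod

/-- The product `e_{A₁} ⋯ e_{Aₖ}` for a sequence of lists `A₁, …, Aₖ`. -/
def eProd (As : List (List (Fin N))) : AlgAC N ε := (As.map (eList ε)).prod

/-- The symmetric difference `A₁ ∆ ⋯ ∆ Aₖ` of a sequence of lists, viewed as sets. -/
def symmDiffs (As : List (List (Fin N))) : Finset (Fin N) :=
  (As.map List.toFinset).foldr (fun S T => symmDiff S T) ∅

/-- The symmetry `O_{A₁, …, Aₖ}`. For a single list `A`, `O ε [A]` is the symmetry `O_A`. -/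
def O (As : List (List (Fin N))) : AlgAC N ε :=
  (1 / 2 : 𝕜) • (dirac ε * xVec ε (symmDiffs As) * eProd ε As
    - eProd ε As * xVec ε (symmDiffs As) * dirac ε - ε • eProd ε As)

/-- The exponent `|A||B| - |A ∩ B|`, with `A = A₁ ∆ ⋯ ∆ Aₖ` and `B = B₁ ∆ ⋯ ∆ Bₗ`; the
subtraction never truncates. -/
def superExp (As Bs : List (List (Fin N))) : ℕ :=
  (symmDiffs As).card * (symmDiffs Bs).card - (symmDiffs As ∩ symmDiffs Bs).card

/-- The supercommutator `⟦O_{A₁, …, Aₖ}, O_{B₁, …, Bₗ}⟧₋`. -/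
def superComm (As Bs : List (List (Fin N))) : AlgAC N ε :=
  O ε As * O ε Bs - (-1) ^ superExp As Bs * (O ε Bs * O ε As)

/-- The super-anticommutator `⟦O_{A₁, …, Aₖ}, O_{B₁, …, Bₗ}⟧₊`. -/
def superAnti (As Bs : List (List (Fin N))) : AlgAC N ε :=
  O ε As * O ε Bs + (-1) ^ superExp As Bs * (O ε Bs * O ε As)

end

/-- The list `A ∩ B`: the elements common to `A` and `B`, in the order of `A`. -/
def interList {N : ℕ} (A B : List (Fin N)) : List (Fin N) := A.filter (fun a => a ∈ B)

end DiracSymm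

end

/-! Write `X_S`, `P_S` for the parts of `∑ x_a e_a` and of the Dirac operator `D` on a set `S`.
Conjugation by `e_A` is, up to a global sign, the reflection that negates the parts on `A`. Moving
`e_A` to the right therefore gives `O_A = (form A - ε) e_A / 2` with `form A = D X_A + X_A D - 2 X_A
P_A` (`O_eq`).

Multiplying two of these, each product `O O'` becomes an element of the ring times a product of
Clifford factors, and that element depends only on the two underlying sets (`O_mul_O`). The sign in
the super-brackets is exactly the one that restores the order of the Clifford factors
(`O_mul_O_swap`). In the theorem every product has the same symmetric difference and, up to a
scalar, the same factor `e_A e_B`. What remains is an identity between values of `pairing`.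

For the blocks `J = A \ B`, `I = A ∩ B`, `K = B \ A`, that identity is `pairing_cross`, with
`pairing K J` and `pairing (J ∪ I ∪ K) I` traded for commutators. The sums over `a` appear because
these commutators, with `G = A ∆ B` fixed, are additive in the set, both inside `G` and outside it
(`pairing_cyclic`, `pairing_additive`). All three identities are noncommutative polynomial
identities modulo the relations between distinct blocks. The mixed relation comes from `[p_i, x_j] =
[p_j, x_i]`, a case of the Jacobi identity. -/

namespace DiracSymm

/-! ### Relations between generators and between disjoint blocks -/

/-- Elements `x_i`, `p_i`, `e_i` of an algebra that satisfy the relations between the generators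
of `𝒜 ⊗ 𝒞` which the symmetries `O_A` depend on. -/
structure DiracSystem {𝕜 : Type*} [RCLike 𝕜] (N : ℕ) (ε : 𝕜) (R : Type*) [Ring R]
    [Algebra 𝕜 R] where
  x : Fin N → R
  p : Fin N → R
  e : Fin N → R
  x_mul_x (i j : Fin N) : x i * x j = x j * x i
  p_mul_p (i j : Fin N) : p i * p j = p j * p i
  p_x_symm (i j : Fin N) : p i * x j - x j * p i = p j * x i - x i * p j
  e_mul_x (i j : Fin N) : e i * x j = x j * e i
  e_mul_p (i j : Fin N) : e i * p j = p j * e i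
  e_mul_self (i : Fin N) : e i * e i = ε • 1
  e_anticomm {i j : Fin N} (h : i ≠ j) : e i * e j = -(e j * e i)

/-- If `x, y` commute, then `[[h, x], y]` is symmetric in `x` and `y`. -/
theorem commutator_symm {R : Type*} [Ring R] {h x y p q : R} (hxy : x * y - y * x = 0)
    (hp : h * x - x * h = p) (hq : h * y - y * h = q) : p * y - y * p = q * x - x * q := by
  subst hp hq
  linear_combination (norm := noncomm_ring) h * hxy - hxy * h

/-- The sign with `e_a e_b = c_{ab} e_b e_a`. -/
def eSign {N : ℕ} (a b : Fin N) : ℤ := if a = b then 1 else -1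

theorem eSign_mul_self {N : ℕ} (a b : Fin N) : eSign a b * eSign a b = 1 := by
  unfold eSign; split_ifs <;> rfl

namespace DiracSystem

variable {𝕜 : Type*} [RCLike 𝕜] {N : ℕ} {ε : 𝕜} {R : Type*} [Ring R] [Algebra 𝕜 R]
  (s : DiracSystem N ε R)

theorem e_mul_e (a b : Fin N) : s.e a * s.e b = eSign a b • (s.e b * s.e a) := by
  unfold eSign
  split_ifs with h
  · simp [h]
  · simp [s.e_anticomm h]

theorem e_mul_xe (a b : Fin N) :
    s.e a * (s.x b * s.e b) = eSign a b • (s.x b * s.e b * s.e a) := by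
  rw [← mul_assoc, e_mul_x, mul_assoc, e_mul_e, mul_smul_comm, mul_assoc]

theorem e_mul_ep (a b : Fin N) :
    s.e a * (s.e b * s.p b) = eSign a b • (s.e b * s.p b * s.e a) := by
  rw [← mul_assoc, e_mul_e, smul_mul_assoc, mul_assoc, e_mul_p, mul_assoc]

/-- `∑ a ∈ S, x_a e_a`. -/
def xVec (S : Finset (Fin N)) : R := ∑ a ∈ S, s.x a * s.e a

/-- `∑ a ∈ S, e_a p_a`. -/
def pVec (S : Finset (Fin N)) : R := ∑ a ∈ S, s.e a * s.p a

theorem xVec_anticomm {S T : Finset (Fin N)} (h : Disjoint S T) :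
    s.xVec S * s.xVec T + s.xVec T * s.xVec S = 0 := by
  simp only [xVec, Finset.sum_mul_sum]
  rw [Finset.sum_comm (s := T), ← Finset.sum_add_distrib]
  refine Finset.sum_eq_zero fun a ha => ?_
  rw [← Finset.sum_add_distrib]
  refine Finset.sum_eq_zero fun b hb => ?_
  have hab : a ≠ b := fun h' => Finset.disjoint_left.1 h ha (h' ▸ hb)
  linear_combination (norm := noncomm_ring) s.x a * s.e_mul_x a b * s.e b
    + s.x b * s.e_mul_x b a * s.e a + s.x_mul_x a b * s.e a * s.e b
    + s.x b * s.x a * s.e_anticomm hab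

theorem pVec_anticomm {S T : Finset (Fin N)} (h : Disjoint S T) :
    s.pVec S * s.pVec T + s.pVec T * s.pVec S = 0 := by
  simp only [pVec, Finset.sum_mul_sum]
  rw [Finset.sum_comm (s := T), ← Finset.sum_add_distrib]
  refine Finset.sum_eq_zero fun a ha => ?_
  rw [← Finset.sum_add_distrib]
  refine Finset.sum_eq_zero fun b hb => ?_
  have hab : a ≠ b := fun h' => Finset.disjoint_left.1 h ha (h' ▸ hb)
  linear_combination (norm := noncomm_ring) -(s.e a * s.e_mul_p b a * s.p b)
    + s.e a * s.e b * s.p_mul_p a b - s.e b * s.e_mul_p a b * s.p a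
    + s.e_anticomm hab * s.p b * s.p a

/-- For `a ≠ b` the anticommutator of `e_a p_a` and `x_b e_b` is `e_a e_b [p_a, x_b]`. The
commutator is symmetric in `a, b` and `e_a e_b` is antisymmetric, so adding the exchanged term gives
zero. -/
theorem pVec_xVec_antisymm {S T : Finset (Fin N)} (h : Disjoint S T) :
    s.pVec S * s.xVec T + s.xVec T * s.pVec S + (s.pVec T * s.xVec S + s.xVec S * s.pVec T)
      = 0 := by
  simp only [pVec, xVec, Finset.sum_mul_sum]
  rw [Finset.sum_comm (s := T), Finset.sum_comm (s := T), ← Finset.sum_add_distrib,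
    ← Finset.sum_add_distrib, ← Finset.sum_add_distrib]
  refine Finset.sum_eq_zero fun a ha => ?_
  simp only [← Finset.sum_add_distrib]
  refine Finset.sum_eq_zero fun b hb => ?_
  have hab : a ≠ b := fun h' => Finset.disjoint_left.1 h ha (h' ▸ hb)
  have h1 (i j : Fin N) : s.e i * s.p i * (s.x j * s.e j) = s.e i * s.e j * (s.p i * s.x j) := by
    rw [← e_mul_x, mul_assoc, ← mul_assoc (s.p i), ← e_mul_p]; simp only [mul_assoc]
  have h2 (i j : Fin N) : s.x i * s.e i * (s.e j * s.p j) = s.e i * s.e j * (s.x i * s.p j) := by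
    rw [← e_mul_x, mul_assoc, ← mul_assoc (s.x i), ← e_mul_x]; simp only [mul_assoc]
  rw [h1, h1, h2, h2]
  linear_combination (norm := noncomm_ring) s.e a * s.e b * s.p_x_symm a b
    + s.e_anticomm hab * (s.x b * s.p a + s.p b * s.x a)

/-- `e_A`. -/
def eList (A : List (Fin N)) : R := (A.map s.e).prod

/-- `e_{A₁} ⋯ e_{Aₖ}`. -/
def eProd (As : List (List (Fin N))) : R := (As.map s.eList).prod

/-- The symmetry `O_{A₁, …, Aₖ}`. -/
def O (As : List (List (Fin N))) : R :=
  (1 / 2 : 𝕜) • (s.pVec Finset.univ * s.xVec (symmDiffs As) * s.eProd As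
    - s.eProd As * s.xVec (symmDiffs As) * s.pVec Finset.univ - ε • s.eProd As)

end DiracSystem

/-! ### The generators of `𝒜 ⊗ 𝒞` satisfy the relations -/

section

variable {𝕜 : Type*} [RCLike 𝕜] (N : ℕ) (ε : 𝕜)

/-- The generators of `𝒜 ⊗ 𝒞`. -/
def genSystem : DiracSystem N ε (AlgAC N ε) where
  x := x ε
  p := p ε
  e := e ε
  x_mul_x i j := by
    have h := RingQuot.mkAlgHom_rel 𝕜 (Rel.xx (𝕜 := 𝕜) i j)
    simp only [comm, map_sub, map_mul, map_zero, sub_eq_zero] at h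
    simp [x, h]
  p_mul_p i j := by
    have h := RingQuot.mkAlgHom_rel 𝕜 (Rel.pp (𝕜 := 𝕜) i j)
    simp only [comm, map_sub, map_mul, map_zero, sub_eq_zero] at h
    simp [p, h]
  p_x_symm i j := by
    have hx := RingQuot.mkAlgHom_rel 𝕜 (Rel.xx (𝕜 := 𝕜) i j)
    have hi := RingQuot.mkAlgHom_rel 𝕜 (Rel.px (𝕜 := 𝕜) i)
    have hj := RingQuot.mkAlgHom_rel 𝕜 (Rel.px (𝕜 := 𝕜) j)
    simp only [comm, map_sub, map_mul, map_zero] at hx hi hj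
    simp only [p, x, Algebra.TensorProduct.tmul_mul_tmul, mul_one, ← TensorProduct.sub_tmul]
    exact congrArg (· ⊗ₜ 1) (commutator_symm hx hi hj)
  e_mul_x i j := by simp [e, x]
  e_mul_p i j := by simp [e, p]
  e_mul_self i := by
    simp [e, CliffordAlgebra.ι_sq_scalar, QuadraticMap.weightedSumSquares_apply, Pi.single_apply,
      Algebra.TensorProduct.one_def, Algebra.algebraMap_eq_smul_one]
  e_anticomm {i j} h := by
    have := CliffordAlgebra.ι_mul_ι_add_swap (Q := cliffForm N ε) (Pi.single i 1) (Pi.single j 1)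
    have h0 : QuadraticMap.polar (cliffForm N ε) (Pi.single i 1) (Pi.single j 1) = 0 := by
      simp only [QuadraticMap.polar, QuadraticMap.weightedSumSquares_apply, Pi.add_apply,
        ← Finset.sum_sub_distrib]
      refine Finset.sum_eq_zero fun k _ => ?_
      by_cases h1 : k = i
      · subst h1; simp [h]
      · simp [h1]
    rw [h0, map_zero] at this
    simp only [e, Algebra.TensorProduct.tmul_mul_tmul, mul_one, ← TensorProduct.tmul_neg]
    rw [eq_neg_of_add_eq_zero_left this]

end

/-! ### Noncommutative polynomial identities for three blocks -/

section NormForm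

variable {R : Type*} [Ring R]

/-- `D x + x D - 2 x p`, which is `2 O_A e_A⁻¹ + ε` for the Dirac operator `D` and the parts `x`
and `p` of `∑ x_a e_a` and `D` on the set `A`. -/
def normForm (D X P : R) : R := D * X + X * D - 2 * X * P

variable (X1 X2 X3 P1 P2 P3 W : R)

-- Quartic part of `pairing_cross`: indices 1, 2, 3 stand for `J`, `I`, `K`, and `W` is the rest of
-- `D`. Each product is a `form` times a `formConj`; the `- 0` keeps the shape of `formConj` when
-- the intersection is empty.
set_option maxHeartbeats 4000000 in
theorem normForm_cross
    (xx12 : X1 * X2 + X2 * X1 = 0)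
    (c12 : P1 * X2 + X2 * P1 + (P2 * X1 + X1 * P2) = 0)
    (xx13 : X1 * X3 + X3 * X1 = 0)
    (c13 : P1 * X3 + X3 * P1 + (P3 * X1 + X1 * P3) = 0)
    (xx23 : X2 * X3 + X3 * X2 = 0)
    (c23 : P2 * X3 + X3 * P2 + (P3 * X2 + X2 * P3) = 0)
    (pp12 : P1 * P2 + P2 * P1 = 0)
    (pp13 : P1 * P3 + P3 * P1 = 0)
    (pp14 : P1 * W + W * P1 = 0)
    (pp23 : P2 * P3 + P3 * P2 = 0)
    (pp24 : P2 * W + W * P2 = 0)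
    (pp34 : P3 * W + W * P3 = 0) :
    normForm (P1 + P2 + P3 + W) (X1 + X2) (P1 + P2) *
      normForm ((P1 + P2 + P3 + W) - 2 * (P1 + P2)) (X3 - X2) (P3 - P2)
    + normForm (P1 + P2 + P3 + W) (X2 + X3) (P2 + P3) *
      normForm ((P1 + P2 + P3 + W) - 2 * (P2 + P3)) (X1 - X2) (P1 - P2)
    - normForm (P1 + P2 + P3 + W) X1 P1 *
      normForm ((P1 + P2 + P3 + W) - 2 * P1) (X3 - 0) (P3 - 0)
    - normForm (P1 + P2 + P3 + W) X3 P3 *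
      normForm ((P1 + P2 + P3 + W) - 2 * P3) (X1 - 0) (P1 - 0)
    - normForm (P1 + P2 + P3 + W) X2 P2 *
      normForm ((P1 + P2 + P3 + W) - 2 * P2) (X1 + X3 - X2) (P1 + P3 - P2)
    - normForm (P1 + P2 + P3 + W) (X1 + X2 + X3) (P1 + P2 + P3) *
      normForm ((P1 + P2 + P3 + W) - 2 * (P1 + P2 + P3)) (0 - X2) (0 - P2) = 0 := by
  simp only [normForm]
  -- A certificate of membership in the two-sided ideal of the relations: each term is a relation
  -- multiplied on the left and right by monomials. Only relations between different blocks occur.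
  linear_combination (norm := noncomm_ring)
    -2 * P1 * X3 * c12 + 2 * P1 * xx23 * P1 + 2 * P1 * xx13 * P2 - 2 * P1 * X2 * c13 + 2 * P1 *
    xx12 * P3 - 2 * P1 * X1 * c23 - 2 * X3 * pp12 * X1 + 2 * X3 * c12 * P1 - 2 * X3 * X1 * pp12
    - 2 * xx23 * P1 * P1 + 2 * xx13 * P1 * P2 - 2 * X2 * pp13 * X1 + 2 * X2 * c13 * P1 - 2 *
    xx12 * P3 * P1 + 2 * X1 * X2 * pp13 - 2 * X1 * pp23 * X1 + 2 * X1 * P3 * c12 - 2 * X1 * c13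
    * P2 + 2 * X1 * P2 * c13 - 2 * X1 * c12 * P3 + 2 * X1 * X1 * pp23 + 2 * X1 * P1 * c23 - 2 *
    P2 * X3 * c12 + 2 * P2 * xx23 * P1 + 2 * P2 * xx13 * P2 - 2 * c12 * X3 * P2 - 2 * P2 * X2 *
    c13 + 2 * P2 * xx12 * P3 - 2 * c12 * X2 * P3 - 2 * c12 * P3 * X2 - 2 * c12 * P2 * X3 + 2 *
    P1 * X2 * c23 + 2 * X3 * pp12 * X2 - 2 * X3 * c12 * P2 + 2 * xx23 * P1 * P2 + 2 * xx13 * P2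
    * P2 + 4 * X2 * pp13 * X2 + 2 * X2 * pp23 * X1 - 2 * X2 * c13 * P2 + 2 * xx12 * P3 * P2 + 2
    * X2 * pp12 * X3 + 2 * X2 * P1 * c23 + 2 * X1 * pp23 * X2 - 2 * X1 * c23 * P2 + 2 * X1 * P2
    * c23 - 2 * P3 * X3 * c12 + 2 * P3 * xx23 * P1 + 2 * P3 * xx13 * P2 - 2 * P3 * X2 * c13 + 2
    * P3 * xx12 * P3 - 2 * c13 * X2 * P3 - 2 * c13 * P3 * X2 - 2 * c13 * P2 * X3 - 2 * c13 * X3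
    * P2 + 2 * P1 * X3 * c23 + 2 * X3 * pp23 * X1 + 2 * X3 * pp13 * X2 - 2 * xx23 * P1 * P3 + 2
    * X3 * c12 * P3 + 2 * X3 * P1 * c23 - 2 * xx13 * P2 * P3 - 2 * X2 * pp13 * X3 + 2 * X2 * c13
    * P3 - 2 * xx12 * P3 * P3 + 2 * X1 * P3 * c23 - 2 * X1 * pp23 * X3 + 2 * X1 * c23 * P3 - 2 *
    W * X3 * c12 + 2 * W * xx23 * P1 + 2 * W * xx13 * P2 - 2 * W * X2 * c13 + 2 * W * xx12 * P3
    - 2 * W * X1 * c23 - 2 * X3 * pp24 * X1 - 2 * X3 * pp14 * X2 - 2 * X3 * c12 * W + 2 * xx23 *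
    P1 * W + 2 * xx13 * P2 * W - 2 * X2 * pp34 * X1 - 2 * X2 * pp14 * X3 - 2 * X2 * c13 * W + 2
    * xx12 * P3 * W - 2 * X1 * pp34 * X2 - 2 * X1 * pp24 * X3 - 2 * X1 * c23 * W

/-- The coefficient of `-ε` in the same combination of pairings; it vanishes already in the free
ring. -/
theorem normForm_cross_linear :
    (normForm (P1 + P2 + P3 + W) (X1 + X2) (P1 + P2) +
      normForm ((P1 + P2 + P3 + W) - 2 * (P1 + P2)) (X3 - X2) (P3 - P2)
      - normForm (P1 + P2 + P3 + W) (X1 + X3) (P1 + P3))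
    + (normForm (P1 + P2 + P3 + W) (X2 + X3) (P2 + P3) +
      normForm ((P1 + P2 + P3 + W) - 2 * (P2 + P3)) (X1 - X2) (P1 - P2)
      - normForm (P1 + P2 + P3 + W) (X1 + X3) (P1 + P3))
    - (normForm (P1 + P2 + P3 + W) X1 P1 + normForm ((P1 + P2 + P3 + W) - 2 * P1) (X3 - 0) (P3 - 0)
      - normForm (P1 + P2 + P3 + W) (X1 + X3) (P1 + P3))
    - (normForm (P1 + P2 + P3 + W) X3 P3 + normForm ((P1 + P2 + P3 + W) - 2 * P3) (X1 - 0) (P1 - 0)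
      - normForm (P1 + P2 + P3 + W) (X1 + X3) (P1 + P3))
    - (normForm (P1 + P2 + P3 + W) X2 P2 +
      normForm ((P1 + P2 + P3 + W) - 2 * P2) (X1 + X3 - X2) (P1 + P3 - P2)
      - normForm (P1 + P2 + P3 + W) (X1 + X3) (P1 + P3))
    - (normForm (P1 + P2 + P3 + W) (X1 + X2 + X3) (P1 + P2 + P3) +
      normForm ((P1 + P2 + P3 + W) - 2 * (P1 + P2 + P3)) (0 - X2) (0 - P2)
      - normForm (P1 + P2 + P3 + W) (X1 + X3) (P1 + P3)) = 0 := by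
  simp only [normForm]
  noncomm_ring

set_option maxHeartbeats 4000000 in
theorem normForm_cyclic
    (xx12 : X1 * X2 + X2 * X1 = 0)
    (c12 : P1 * X2 + X2 * P1 + (P2 * X1 + X1 * P2) = 0)
    (xx13 : X1 * X3 + X3 * X1 = 0)
    (c13 : P1 * X3 + X3 * P1 + (P3 * X1 + X1 * P3) = 0)
    (xx23 : X2 * X3 + X3 * X2 = 0)
    (c23 : P2 * X3 + X3 * P2 + (P3 * X2 + X2 * P3) = 0)
    (pp12 : P1 * P2 + P2 * P1 = 0)
    (pp13 : P1 * P3 + P3 * P1 = 0)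
    (pp14 : P1 * W + W * P1 = 0)
    (pp23 : P2 * P3 + P3 * P2 = 0)
    (pp24 : P2 * W + W * P2 = 0)
    (pp34 : P3 * W + W * P3 = 0) :
    normForm (P1 + P2 + P3 + W) X1 P1 *
      normForm ((P1 + P2 + P3 + W) - 2 * P1) (X2 + X3 - 0) (P2 + P3 - 0)
    - normForm (P1 + P2 + P3 + W) (X2 + X3) (P2 + P3) *
      normForm ((P1 + P2 + P3 + W) - 2 * (P2 + P3)) (X1 - 0) (P1 - 0)
    + normForm (P1 + P2 + P3 + W) X2 P2 *
      normForm ((P1 + P2 + P3 + W) - 2 * P2) (X1 + X3 - 0) (P1 + P3 - 0)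
    - normForm (P1 + P2 + P3 + W) (X1 + X3) (P1 + P3) *
      normForm ((P1 + P2 + P3 + W) - 2 * (P1 + P3)) (X2 - 0) (P2 - 0)
    + normForm (P1 + P2 + P3 + W) X3 P3 *
      normForm ((P1 + P2 + P3 + W) - 2 * P3) (X1 + X2 - 0) (P1 + P2 - 0)
    - normForm (P1 + P2 + P3 + W) (X1 + X2) (P1 + P2) *
      normForm ((P1 + P2 + P3 + W) - 2 * (P1 + P2)) (X3 - 0) (P3 - 0) = 0 := by
  simp only [normForm]
  linear_combination (norm := noncomm_ring)
    2 * P1 * X3 * c12 - 2 * P1 * xx23 * P1 - 2 * P1 * xx13 * P2 + 2 * P1 * X2 * c13 - 2 * P1 *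
    xx12 * P3 + 2 * P1 * X1 * c23 + 2 * X3 * pp12 * X1 - 2 * X3 * c12 * P1 + 2 * X3 * X1 * pp12
    + 2 * xx23 * P1 * P1 - 2 * xx13 * P1 * P2 + 2 * X2 * pp13 * X1 - 2 * X2 * c13 * P1 + 2 *
    xx12 * P3 * P1 - 2 * X1 * X2 * pp13 + 2 * X1 * pp23 * X1 - 2 * X1 * P3 * c12 + 2 * X1 * c13
    * P2 - 2 * X1 * P2 * c13 + 2 * X1 * c12 * P3 - 2 * X1 * X1 * pp23 - 2 * X1 * P1 * c23 + 2 *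
    P2 * X3 * c12 - 2 * P2 * xx23 * P1 - 2 * P2 * xx13 * P2 + 2 * c12 * X3 * P2 + 2 * P2 * X2 *
    c13 - 2 * P2 * xx12 * P3 + 2 * c12 * X2 * P3 + 2 * c12 * P3 * X2 + 2 * c12 * P2 * X3 - 2 *
    P1 * X2 * c23 + 2 * X3 * pp12 * X2 - 2 * X3 * c12 * P2 + 2 * xx23 * P1 * P2 + 2 * xx13 * P2
    * P2 - 2 * X2 * pp23 * X1 - 2 * X2 * c13 * P2 + 2 * xx12 * P3 * P2 - 2 * X2 * pp12 * X3 - 2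
    * X2 * P1 * c23 + 2 * X1 * pp23 * X2 - 2 * X1 * c23 * P2 - 2 * X1 * P2 * c23 + 2 * P3 * X3 *
    c12 - 2 * P3 * xx23 * P1 - 2 * P3 * xx13 * P2 + 2 * P3 * X2 * c13 - 2 * P3 * xx12 * P3 + 2 *
    c13 * X2 * P3 + 2 * c13 * P3 * X2 + 2 * c13 * P2 * X3 + 2 * c13 * X3 * P2 - 2 * P1 * X3 *
    c23 - 2 * X3 * pp23 * X1 - 2 * X3 * pp13 * X2 + 2 * xx23 * P1 * P3 - 2 * X3 * c12 * P3 - 2 *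
    X3 * P1 * c23 + 2 * xx13 * P2 * P3 + 2 * X2 * pp13 * X3 - 2 * X2 * c13 * P3 + 2 * xx12 * P3
    * P3 - 2 * X1 * P3 * c23 + 2 * X1 * pp23 * X3 - 2 * X1 * c23 * P3 + 2 * W * X3 * c12 - 2 * W
    * xx23 * P1 - 2 * W * xx13 * P2 + 2 * W * X2 * c13 - 2 * W * xx12 * P3 + 2 * W * X1 * c23 +
    2 * X3 * pp24 * X1 + 2 * X3 * pp14 * X2 + 2 * X3 * c12 * W - 2 * xx23 * P1 * W - 2 * xx13 *
    P2 * W + 2 * X2 * pp34 * X1 + 2 * X2 * pp14 * X3 + 2 * X2 * c13 * W - 2 * xx12 * P3 * W + 2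
    * X1 * pp34 * X2 + 2 * X1 * pp24 * X3 + 2 * X1 * c23 * W

theorem normForm_cyclic_linear :
    (normForm (P1 + P2 + P3 + W) X1 P1 +
      normForm ((P1 + P2 + P3 + W) - 2 * P1) (X2 + X3 - 0) (P2 + P3 - 0)
      - normForm (P1 + P2 + P3 + W) (X1 + X2 + X3) (P1 + P2 + P3))
    - (normForm (P1 + P2 + P3 + W) (X2 + X3) (P2 + P3) +
      normForm ((P1 + P2 + P3 + W) - 2 * (P2 + P3)) (X1 - 0) (P1 - 0)
      - normForm (P1 + P2 + P3 + W) (X1 + X2 + X3) (P1 + P2 + P3))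
    + (normForm (P1 + P2 + P3 + W) X2 P2 +
      normForm ((P1 + P2 + P3 + W) - 2 * P2) (X1 + X3 - 0) (P1 + P3 - 0)
      - normForm (P1 + P2 + P3 + W) (X1 + X2 + X3) (P1 + P2 + P3))
    - (normForm (P1 + P2 + P3 + W) (X1 + X3) (P1 + P3) +
      normForm ((P1 + P2 + P3 + W) - 2 * (P1 + P3)) (X2 - 0) (P2 - 0)
      - normForm (P1 + P2 + P3 + W) (X1 + X2 + X3) (P1 + P2 + P3))
    + (normForm (P1 + P2 + P3 + W) X3 P3 +
      normForm ((P1 + P2 + P3 + W) - 2 * P3) (X1 + X2 - 0) (P1 + P2 - 0)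
      - normForm (P1 + P2 + P3 + W) (X1 + X2 + X3) (P1 + P2 + P3))
    - (normForm (P1 + P2 + P3 + W) (X1 + X2) (P1 + P2) +
      normForm ((P1 + P2 + P3 + W) - 2 * (P1 + P2)) (X3 - 0) (P3 - 0)
      - normForm (P1 + P2 + P3 + W) (X1 + X2 + X3) (P1 + P2 + P3)) = 0 := by
  simp only [normForm]
  noncomm_ring

set_option maxHeartbeats 4000000 in
theorem normForm_additive
    (xx12 : X1 * X2 + X2 * X1 = 0)
    (c12 : P1 * X2 + X2 * P1 + (P2 * X1 + X1 * P2) = 0)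
    (xx13 : X1 * X3 + X3 * X1 = 0)
    (c13 : P1 * X3 + X3 * P1 + (P3 * X1 + X1 * P3) = 0)
    (xx23 : X2 * X3 + X3 * X2 = 0)
    (c23 : P2 * X3 + X3 * P2 + (P3 * X2 + X2 * P3) = 0)
    (pp12 : P1 * P2 + P2 * P1 = 0)
    (pp13 : P1 * P3 + P3 * P1 = 0)
    (pp14 : P1 * W + W * P1 = 0)
    (pp23 : P2 * P3 + P3 * P2 = 0)
    (pp24 : P2 * W + W * P2 = 0)
    (pp34 : P3 * W + W * P3 = 0) :
    normForm (P1 + P2 + P3 + W) (X1 + X2) (P1 + P2) *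
      normForm ((P1 + P2 + P3 + W) - 2 * (P1 + P2)) (X3 - (X1 + X2)) (P3 - (P1 + P2))
    - normForm (P1 + P2 + P3 + W) (X1 + X2 + X3) (P1 + P2 + P3) *
      normForm ((P1 + P2 + P3 + W) - 2 * (P1 + P2 + P3)) (0 - (X1 + X2)) (0 - (P1 + P2))
    - normForm (P1 + P2 + P3 + W) X1 P1 *
      normForm ((P1 + P2 + P3 + W) - 2 * P1) (X3 - X1) (P3 - P1)
    + normForm (P1 + P2 + P3 + W) (X1 + X3) (P1 + P3) *
      normForm ((P1 + P2 + P3 + W) - 2 * (P1 + P3)) (0 - X1) (0 - P1)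
    - normForm (P1 + P2 + P3 + W) X2 P2 *
      normForm ((P1 + P2 + P3 + W) - 2 * P2) (X3 - X2) (P3 - P2)
    + normForm (P1 + P2 + P3 + W) (X2 + X3) (P2 + P3) *
      normForm ((P1 + P2 + P3 + W) - 2 * (P2 + P3)) (0 - X2) (0 - P2) = 0 := by
  simp only [normForm]
  linear_combination (norm := noncomm_ring)
    -2 * P1 * X3 * c12 + 2 * P1 * xx23 * P1 + 2 * P1 * xx13 * P2 - 2 * P1 * X2 * c13 + 2 * P1 *
    xx12 * P3 - 2 * P1 * X1 * c23 + 2 * X3 * pp12 * X1 - 2 * X3 * c12 * P1 + 2 * X3 * X1 * pp12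
    + 2 * xx23 * P1 * P1 - 2 * xx13 * P1 * P2 + 2 * X2 * pp13 * X1 - 2 * X2 * c13 * P1 + 2 *
    xx12 * P3 * P1 - 2 * X1 * X2 * pp13 - 2 * X1 * P3 * c12 + 4 * X1 * pp13 * X2 + 6 * X1 * pp23
    * X1 + 2 * X1 * c13 * P2 - 2 * X1 * P2 * c13 + 4 * X1 * pp12 * X3 + 2 * X1 * c12 * P3 - 2 *
    X1 * X1 * pp23 - 2 * X1 * P1 * c23 - 2 * P2 * X3 * c12 + 2 * P2 * xx23 * P1 + 2 * P2 * xx13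
    * P2 - 2 * c12 * X3 * P2 - 2 * P2 * X2 * c13 + 2 * P2 * xx12 * P3 - 2 * c12 * X2 * P3 - 2 *
    c12 * P3 * X2 - 2 * c12 * P2 * X3 + 2 * P1 * X2 * c23 + 2 * X3 * pp12 * X2 - 2 * X3 * c12 *
    P2 + 2 * xx23 * P1 * P2 + 2 * xx13 * P2 * P2 + 4 * X2 * pp13 * X2 + 2 * X2 * pp23 * X1 - 2 *
    X2 * c13 * P2 + 2 * xx12 * P3 * P2 + 2 * X2 * pp12 * X3 + 2 * X2 * P1 * c23 + 2 * X1 * pp23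
    * X2 - 2 * X1 * c23 * P2 + 2 * X1 * P2 * c23 - 2 * P3 * X3 * c12 + 2 * P3 * xx23 * P1 + 2 *
    P3 * xx13 * P2 - 2 * P3 * X2 * c13 + 2 * P3 * xx12 * P3 - 2 * c13 * X2 * P3 - 2 * c13 * P3 *
    X2 - 2 * c13 * P2 * X3 - 2 * c13 * X3 * P2 + 2 * P1 * X3 * c23 + 2 * X3 * pp23 * X1 + 2 * X3
    * pp13 * X2 - 2 * xx23 * P1 * P3 + 2 * X3 * c12 * P3 + 2 * X3 * P1 * c23 - 2 * xx13 * P2 *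
    P3 - 2 * X2 * pp13 * X3 + 2 * X2 * c13 * P3 - 2 * xx12 * P3 * P3 + 2 * X1 * P3 * c23 - 2 *
    X1 * pp23 * X3 + 2 * X1 * c23 * P3 - 2 * W * X3 * c12 + 2 * W * xx23 * P1 + 2 * W * xx13 *
    P2 - 2 * W * X2 * c13 + 2 * W * xx12 * P3 - 2 * W * X1 * c23 - 2 * X3 * pp24 * X1 - 2 * X3 *
    pp14 * X2 - 2 * X3 * c12 * W + 2 * xx23 * P1 * W + 2 * xx13 * P2 * W - 2 * X2 * pp34 * X1 -
    2 * X2 * pp14 * X3 - 2 * X2 * c13 * W + 2 * xx12 * P3 * W - 2 * X1 * pp34 * X2 - 2 * X1 *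
    pp24 * X3 - 2 * X1 * c23 * W

theorem normForm_additive_linear :
    (normForm (P1 + P2 + P3 + W) (X1 + X2) (P1 + P2) +
      normForm ((P1 + P2 + P3 + W) - 2 * (P1 + P2)) (X3 - (X1 + X2)) (P3 - (P1 + P2))
      - normForm (P1 + P2 + P3 + W) X3 P3)
    - (normForm (P1 + P2 + P3 + W) (X1 + X2 + X3) (P1 + P2 + P3) +
      normForm ((P1 + P2 + P3 + W) - 2 * (P1 + P2 + P3)) (0 - (X1 + X2)) (0 - (P1 + P2))
      - normForm (P1 + P2 + P3 + W) X3 P3)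
    - (normForm (P1 + P2 + P3 + W) X1 P1 +
      normForm ((P1 + P2 + P3 + W) - 2 * P1) (X3 - X1) (P3 - P1)
      - normForm (P1 + P2 + P3 + W) X3 P3)
    + (normForm (P1 + P2 + P3 + W) (X1 + X3) (P1 + P3) +
      normForm ((P1 + P2 + P3 + W) - 2 * (P1 + P3)) (0 - X1) (0 - P1)
      - normForm (P1 + P2 + P3 + W) X3 P3)
    - (normForm (P1 + P2 + P3 + W) X2 P2 +
      normForm ((P1 + P2 + P3 + W) - 2 * P2) (X3 - X2) (P3 - P2)
      - normForm (P1 + P2 + P3 + W) X3 P3)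
    + (normForm (P1 + P2 + P3 + W) (X2 + X3) (P2 + P3) +
      normForm ((P1 + P2 + P3 + W) - 2 * (P2 + P3)) (0 - X2) (0 - P2)
      - normForm (P1 + P2 + P3 + W) X3 P3) = 0 := by
  simp only [normForm]
  noncomm_ring

end NormForm

/-! ### Pairings of index sets and their additivity -/

namespace DiracSystem

variable {𝕜 : Type*} [RCLike 𝕜] {N : ℕ} {ε : 𝕜} {R : Type*} [Ring R] [Algebra 𝕜 R]
  (s : DiracSystem N ε R)

theorem xVec_union {S T : Finset (Fin N)} (h : Disjoint S T) :
    s.xVec (S ∪ T) = s.xVec S + s.xVec T := Finset.sum_union h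

theorem pVec_union {S T : Finset (Fin N)} (h : Disjoint S T) :
    s.pVec (S ∪ T) = s.pVec S + s.pVec T := Finset.sum_union h

@[simp] theorem xVec_empty : s.xVec ∅ = 0 := Finset.sum_empty

@[simp] theorem pVec_empty : s.pVec ∅ = 0 := Finset.sum_empty

/-- The element with `O_A = (form A - ε) e_A / 2`. -/
def form (S : Finset (Fin N)) : R := normForm (s.pVec Finset.univ) (s.xVec S) (s.pVec S)

/-- The conjugate of `form T` by `e_S`. -/
def formConj (S T : Finset (Fin N)) : R :=
  normForm (s.pVec Finset.univ - 2 * s.pVec S) (s.xVec (T \ S) - s.xVec (T ∩ S))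
    (s.pVec (T \ S) - s.pVec (T ∩ S))

/-- The element with `4 O_A O_B + 2 ε O_{A, B} = pairing A B e_A e_B`. -/
def pairing (S T : Finset (Fin N)) : R :=
  s.form S * s.formConj S T - ε • (s.form S + s.formConj S T - s.form (symmDiff S T))

theorem formConj_eq {S T U V : Finset (Fin N)} (hU : T \ S = U) (hV : T ∩ S = V) :
    s.formConj S T = normForm (s.pVec Finset.univ - 2 * s.pVec S) (s.xVec U - s.xVec V)
      (s.pVec U - s.pVec V) := by
  subst hU hV; rfl

section Blocks

variable {J I K : Finset (Fin N)}

theorem pVec_univ_eq (hJI : Disjoint J I) (hJK : Disjoint J K) (hIK : Disjoint I K) :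
    s.pVec Finset.univ = s.pVec J + s.pVec I + s.pVec K + s.pVec (J ∪ I ∪ K)ᶜ := by
  rw [← pVec_union s hJI, ← pVec_union s (Finset.disjoint_union_left.2 ⟨hJK, hIK⟩),
    ← pVec_union s disjoint_compl_right, Finset.union_compl]

theorem pairing_cross (hJI : Disjoint J I) (hJK : Disjoint J K) (hIK : Disjoint I K) :
    s.pairing (J ∪ I) (I ∪ K) + s.pairing (I ∪ K) (J ∪ I) =
      s.pairing J K + s.pairing K J + s.pairing I (J ∪ I ∪ K) + s.pairing (J ∪ I ∪ K) I := by
  have hJIK : Disjoint (J ∪ I) K := Finset.disjoint_union_left.2 ⟨hJK, hIK⟩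
  have hR : Disjoint (J ∪ I ∪ K) (J ∪ I ∪ K)ᶜ := disjoint_compl_right
  obtain ⟨⟨hJR, hIR⟩, hKR⟩ : (Disjoint J (J ∪ I ∪ K)ᶜ ∧ Disjoint I (J ∪ I ∪ K)ᶜ) ∧
      Disjoint K (J ∪ I ∪ K)ᶜ := by simpa only [Finset.disjoint_union_left] using hR
  have h := normForm_cross _ _ _ _ _ _ _ (s.xVec_anticomm hJI) (s.pVec_xVec_antisymm hJI)
    (s.xVec_anticomm hJK) (s.pVec_xVec_antisymm hJK) (s.xVec_anticomm hIK)
    (s.pVec_xVec_antisymm hIK) (s.pVec_anticomm hJI) (s.pVec_anticomm hJK) (s.pVec_anticomm hJR)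
    (s.pVec_anticomm hIK) (s.pVec_anticomm hIR) (s.pVec_anticomm hKR)
  have hl := normForm_cross_linear (s.xVec J) (s.xVec I) (s.xVec K) (s.pVec J) (s.pVec I)
    (s.pVec K) (s.pVec (J ∪ I ∪ K)ᶜ)
  rw [← s.pVec_univ_eq hJI hJK hIK] at h hl
  rw [Finset.disjoint_left] at hJI hJK hIK
  -- All six pairs have the same symmetric difference, so a single correction term `form (J ∪ K)`
  -- occurs throughout.
  have d1 : symmDiff (J ∪ I) (I ∪ K) = J ∪ K := by ext; simp [Finset.mem_symmDiff]; grind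
  have d2 : symmDiff (I ∪ K) (J ∪ I) = J ∪ K := by ext; simp [Finset.mem_symmDiff]; grind
  have d3 : symmDiff J K = J ∪ K := by ext; simp [Finset.mem_symmDiff]; grind
  have d4 : symmDiff K J = J ∪ K := by ext; simp [Finset.mem_symmDiff]; grind
  have d5 : symmDiff I (J ∪ I ∪ K) = J ∪ K := by ext; simp [Finset.mem_symmDiff]; grind
  have d6 : symmDiff (J ∪ I ∪ K) I = J ∪ K := by ext; simp [Finset.mem_symmDiff]; grind
  simp only [pairing, d1, d2, d3, d4, d5, d6]
  rw [s.formConj_eq (S := J ∪ I) (T := I ∪ K) (U := K) (V := I) (by grind) (by grind),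
    s.formConj_eq (S := I ∪ K) (T := J ∪ I) (U := J) (V := I) (by grind) (by grind),
    s.formConj_eq (S := J) (T := K) (U := K) (V := ∅) (by grind) (by grind),
    s.formConj_eq (S := K) (T := J) (U := J) (V := ∅) (by grind) (by grind),
    s.formConj_eq (S := I) (T := J ∪ I ∪ K) (U := J ∪ K) (V := I) (by grind) (by grind),
    s.formConj_eq (S := J ∪ I ∪ K) (T := I) (U := ∅) (V := I) (by grind) (by grind)]
  rw [← Finset.disjoint_left] at hJI hJK hIK
  simp only [form, s.xVec_union hJIK, s.pVec_union hJIK, s.xVec_union hJI, s.pVec_union hJI,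
    s.xVec_union hIK, s.pVec_union hIK, s.xVec_union hJK, s.pVec_union hJK, xVec_empty, pVec_empty]
  linear_combination (norm := module) h - ε • hl

theorem pairing_cyclic (hJI : Disjoint J I) (hJK : Disjoint J K) (hIK : Disjoint I K) :
    s.pairing J (I ∪ K) - s.pairing (I ∪ K) J + (s.pairing I (J ∪ K) - s.pairing (J ∪ K) I)
      + (s.pairing K (J ∪ I) - s.pairing (J ∪ I) K) = 0 := by
  have hJIK : Disjoint (J ∪ I) K := Finset.disjoint_union_left.2 ⟨hJK, hIK⟩
  have hR : Disjoint (J ∪ I ∪ K) (J ∪ I ∪ K)ᶜ := disjoint_compl_right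
  obtain ⟨⟨hJR, hIR⟩, hKR⟩ : (Disjoint J (J ∪ I ∪ K)ᶜ ∧ Disjoint I (J ∪ I ∪ K)ᶜ) ∧
      Disjoint K (J ∪ I ∪ K)ᶜ := by simpa only [Finset.disjoint_union_left] using hR
  have h := normForm_cyclic _ _ _ _ _ _ _ (s.xVec_anticomm hJI) (s.pVec_xVec_antisymm hJI)
    (s.xVec_anticomm hJK) (s.pVec_xVec_antisymm hJK) (s.xVec_anticomm hIK)
    (s.pVec_xVec_antisymm hIK) (s.pVec_anticomm hJI) (s.pVec_anticomm hJK) (s.pVec_anticomm hJR)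
    (s.pVec_anticomm hIK) (s.pVec_anticomm hIR) (s.pVec_anticomm hKR)
  have hl := normForm_cyclic_linear (s.xVec J) (s.xVec I) (s.xVec K) (s.pVec J) (s.pVec I)
    (s.pVec K) (s.pVec (J ∪ I ∪ K)ᶜ)
  rw [← s.pVec_univ_eq hJI hJK hIK] at h hl
  rw [Finset.disjoint_left] at hJI hJK hIK
  have d1 : symmDiff J (I ∪ K) = J ∪ I ∪ K := by ext; simp [Finset.mem_symmDiff]; grind
  have d2 : symmDiff (I ∪ K) J = J ∪ I ∪ K := by ext; simp [Finset.mem_symmDiff]; grind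
  have d3 : symmDiff I (J ∪ K) = J ∪ I ∪ K := by ext; simp [Finset.mem_symmDiff]; grind
  have d4 : symmDiff (J ∪ K) I = J ∪ I ∪ K := by ext; simp [Finset.mem_symmDiff]; grind
  have d5 : symmDiff K (J ∪ I) = J ∪ I ∪ K := by ext; simp [Finset.mem_symmDiff]; grind
  have d6 : symmDiff (J ∪ I) K = J ∪ I ∪ K := by ext; simp [Finset.mem_symmDiff]; grind
  simp only [pairing, d1, d2, d3, d4, d5, d6]
  rw [s.formConj_eq (S := J) (T := (I ∪ K)) (U := (I ∪ K)) (V := ∅) (by grind) (by grind),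
    s.formConj_eq (S := (I ∪ K)) (T := J) (U := J) (V := ∅) (by grind) (by grind),
    s.formConj_eq (S := I) (T := (J ∪ K)) (U := (J ∪ K)) (V := ∅) (by grind) (by grind),
    s.formConj_eq (S := (J ∪ K)) (T := I) (U := I) (V := ∅) (by grind) (by grind),
    s.formConj_eq (S := K) (T := (J ∪ I)) (U := (J ∪ I)) (V := ∅) (by grind) (by grind),
    s.formConj_eq (S := (J ∪ I)) (T := K) (U := K) (V := ∅) (by grind) (by grind)]
  rw [← Finset.disjoint_left] at hJI hJK hIK
  simp only [form, s.xVec_union hJIK, s.pVec_union hJIK, s.xVec_union hJI, s.pVec_union hJI,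
    s.xVec_union hIK, s.pVec_union hIK, s.xVec_union hJK, s.pVec_union hJK, xVec_empty, pVec_empty]
  linear_combination (norm := module) h - ε • hl

theorem pairing_additive (hJI : Disjoint J I) (hJK : Disjoint J K) (hIK : Disjoint I K) :
    s.pairing (J ∪ I) (J ∪ I ∪ K) - s.pairing (J ∪ I ∪ K) (J ∪ I) =
      s.pairing J (J ∪ K) - s.pairing (J ∪ K) J + (s.pairing I (I ∪ K) - s.pairing (I ∪ K) I) := by
  have hJIK : Disjoint (J ∪ I) K := Finset.disjoint_union_left.2 ⟨hJK, hIK⟩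
  have hR : Disjoint (J ∪ I ∪ K) (J ∪ I ∪ K)ᶜ := disjoint_compl_right
  obtain ⟨⟨hJR, hIR⟩, hKR⟩ : (Disjoint J (J ∪ I ∪ K)ᶜ ∧ Disjoint I (J ∪ I ∪ K)ᶜ) ∧
      Disjoint K (J ∪ I ∪ K)ᶜ := by simpa only [Finset.disjoint_union_left] using hR
  have h := normForm_additive _ _ _ _ _ _ _ (s.xVec_anticomm hJI) (s.pVec_xVec_antisymm hJI)
    (s.xVec_anticomm hJK) (s.pVec_xVec_antisymm hJK) (s.xVec_anticomm hIK)
    (s.pVec_xVec_antisymm hIK) (s.pVec_anticomm hJI) (s.pVec_anticomm hJK) (s.pVec_anticomm hJR)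
    (s.pVec_anticomm hIK) (s.pVec_anticomm hIR) (s.pVec_anticomm hKR)
  have hl := normForm_additive_linear (s.xVec J) (s.xVec I) (s.xVec K) (s.pVec J) (s.pVec I)
    (s.pVec K) (s.pVec (J ∪ I ∪ K)ᶜ)
  rw [← s.pVec_univ_eq hJI hJK hIK] at h hl
  rw [Finset.disjoint_left] at hJI hJK hIK
  have d1 : symmDiff (J ∪ I) (J ∪ I ∪ K) = K := by ext; simp [Finset.mem_symmDiff]; grind
  have d2 : symmDiff (J ∪ I ∪ K) (J ∪ I) = K := by ext; simp [Finset.mem_symmDiff]; grind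
  have d3 : symmDiff J (J ∪ K) = K := by ext; simp [Finset.mem_symmDiff]; grind
  have d4 : symmDiff (J ∪ K) J = K := by ext; simp [Finset.mem_symmDiff]; grind
  have d5 : symmDiff I (I ∪ K) = K := by ext; simp [Finset.mem_symmDiff]; grind
  have d6 : symmDiff (I ∪ K) I = K := by ext; simp [Finset.mem_symmDiff]; grind
  simp only [pairing, d1, d2, d3, d4, d5, d6]
  rw [s.formConj_eq (S := (J ∪ I)) (T := (J ∪ I ∪ K)) (U := K) (V := (J ∪ I)) (by grind) (by grind),
    s.formConj_eq (S := J ∪ I ∪ K) (T := (J ∪ I)) (U := ∅) (V := (J ∪ I)) (by grind) (by grind),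
    s.formConj_eq (S := J) (T := (J ∪ K)) (U := K) (V := J) (by grind) (by grind),
    s.formConj_eq (S := (J ∪ K)) (T := J) (U := ∅) (V := J) (by grind) (by grind),
    s.formConj_eq (S := I) (T := (I ∪ K)) (U := K) (V := I) (by grind) (by grind),
    s.formConj_eq (S := (I ∪ K)) (T := I) (U := ∅) (V := I) (by grind) (by grind)]
  rw [← Finset.disjoint_left] at hJI hJK hIK
  simp only [form, s.xVec_union hJIK, s.pVec_union hJIK, s.xVec_union hJI, s.pVec_union hJI,
    s.xVec_union hIK, s.pVec_union hIK, s.xVec_union hJK, s.pVec_union hJK, xVec_empty, pVec_empty]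
  linear_combination (norm := module) h - ε • hl

/-- `4 ε` times `⟦O_S, O_{S, G}⟧₋` is `pairingComm G S e_G`. -/
def pairingComm (G S : Finset (Fin N)) : R :=
  s.pairing S (symmDiff S G) - s.pairing (symmDiff S G) S

theorem pairingComm_empty (G : Finset (Fin N)) : s.pairingComm G ∅ = 0 := by
  simp [pairingComm, pairing, formConj, form, normForm, show symmDiff ∅ G = G from bot_symmDiff G,
    show symmDiff G ∅ = G from symmDiff_bot G]

/-- Inside `G`, symmetric difference with `G` is the complement in `G`. With `K = G \ (J ∪ I)`, the
third bracket of `pairing_cyclic` is minus the one for `J ∪ I`, so the cyclic identity is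
additivity. -/
theorem pairingComm_union_of_subset {G : Finset (Fin N)} (h : Disjoint J I) (hJ : J ⊆ G)
    (hI : I ⊆ G) : s.pairingComm G (J ∪ I) = s.pairingComm G J + s.pairingComm G I := by
  have hK : Disjoint (J ∪ I) (G \ (J ∪ I)) := Finset.disjoint_sdiff
  have hJK := (Finset.disjoint_union_left.1 hK).1
  have hIK := (Finset.disjoint_union_left.1 hK).2
  have key := s.pairing_cyclic h hJK hIK
  rw [Finset.disjoint_left] at h
  have d1 : symmDiff (J ∪ I) G = G \ (J ∪ I) := by ext; simp [Finset.mem_symmDiff]; grind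
  have d2 : symmDiff J G = I ∪ G \ (J ∪ I) := by ext; simp [Finset.mem_symmDiff]; grind
  have d3 : symmDiff I G = J ∪ G \ (J ∪ I) := by ext; simp [Finset.mem_symmDiff]; grind
  simp only [pairingComm, d1, d2, d3]
  linear_combination (norm := abel) -key

theorem pairingComm_union_of_disjoint {G : Finset (Fin N)} (h : Disjoint J I)
    (hJ : Disjoint J G) (hI : Disjoint I G) :
    s.pairingComm G (J ∪ I) = s.pairingComm G J + s.pairingComm G I := by
  have key := s.pairing_additive h hJ hI
  have d1 : symmDiff (J ∪ I) G = J ∪ I ∪ G :=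
    (Finset.disjoint_union_left.2 ⟨hJ, hI⟩).symmDiff_eq_sup
  have d2 : symmDiff J G = J ∪ G := hJ.symmDiff_eq_sup
  have d3 : symmDiff I G = I ∪ G := hI.symmDiff_eq_sup
  simpa only [pairingComm, d1, d2, d3] using key

end Blocks

theorem sum_pairingComm_of_subset {G S : Finset (Fin N)} (h : S ⊆ G) :
    ∑ a ∈ S, s.pairingComm G {a} = s.pairingComm G S := by
  induction S using Finset.induction_on with
  | empty => simp [pairingComm_empty]
  | insert a S ha ih =>
    obtain ⟨haG, hS⟩ := Finset.insert_subset_iff.1 h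
    rw [Finset.sum_insert ha, ih hS, Finset.insert_eq, s.pairingComm_union_of_subset
      (Finset.disjoint_singleton_left.2 ha) (Finset.singleton_subset_iff.2 haG) hS]

theorem sum_pairingComm_of_disjoint {G S : Finset (Fin N)} (h : Disjoint S G) :
    ∑ a ∈ S, s.pairingComm G {a} = s.pairingComm G S := by
  induction S using Finset.induction_on with
  | empty => simp [pairingComm_empty]
  | insert a S ha ih =>
    obtain ⟨haG, hS⟩ := Finset.disjoint_insert_left.1 h
    rw [Finset.sum_insert ha, ih hS, Finset.insert_eq, s.pairingComm_union_of_disjoint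
      (Finset.disjoint_singleton_left.2 ha) (Finset.disjoint_singleton_left.2 haG) hS]

end DiracSystem

/-! ### Signs from moving Clifford products -/

/-- Common elements contribute a square, which is 1. Hence commutation signs of `e_{A₁} ⋯ e_{Aₖ}`
depend only on the symmetric difference of the lists. -/
theorem prod_symmDiff_of_mul_self {ι : Type*} [DecidableEq ι] {f : ι → ℤ}
    (hf : ∀ a, f a * f a = 1) (S T : Finset ι) :
    ∏ a ∈ symmDiff S T, f a = (∏ a ∈ S, f a) * ∏ a ∈ T, f a := by
  have h : (∏ a ∈ S ∩ T, f a) * ∏ a ∈ S ∩ T, f a = 1 := by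
    rw [← Finset.prod_mul_distrib]; exact Finset.prod_eq_one fun a _ => hf a
  have hd : Disjoint (S \ T) (T \ S) := disjoint_sdiff_sdiff
  rw [symmDiff, Finset.sup_eq_union, Finset.prod_union hd, ← Finset.prod_inter_mul_prod_sdiff S T f,
    ← Finset.prod_inter_mul_prod_sdiff T S f, Finset.inter_comm T S]
  linear_combination -((∏ a ∈ S \ T, f a) * ∏ a ∈ T \ S, f a) * h

theorem prod_eSign (S : Finset (Fin N)) (b : Fin N) :
    ∏ a ∈ S, eSign a b = (-1) ^ (S.erase b).card := by
  rw [← Finset.prod_erase S (f := fun a => eSign a b) (a := b) (by simp [eSign]),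
    ← Finset.prod_const]
  exact Finset.prod_congr rfl fun a ha => by simp [eSign, Finset.ne_of_mem_erase ha]

/-- A sign arises from each pair with `a ≠ b`, and `|S||T| - |S ∩ T|` counts these pairs: this is
the exponent in the super-brackets. -/
theorem prod_prod_eSign (S T : Finset (Fin N)) :
    ∏ a ∈ S, ∏ b ∈ T, eSign b a = (-1) ^ (S.card * T.card - (S ∩ T).card) := by
  simp only [prod_eSign, Finset.prod_pow_eq_pow_sum]
  congr 1
  have h : ∑ a ∈ S, ((T.erase a).card + if a ∈ T then 1 else 0) = S.card * T.card := by
    rw [← smul_eq_mul, ← Finset.sum_const]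
    refine Finset.sum_congr rfl fun a _ => ?_
    split_ifs with ha
    · exact Finset.card_erase_add_one ha
    · rw [Finset.erase_eq_of_notMem ha, add_zero]
  rw [Finset.sum_add_distrib, ← Finset.card_filter, Finset.filter_mem_eq_inter] at h
  omega

theorem symmDiffs_cons (A : List (Fin N)) (As : List (List (Fin N))) :
    symmDiffs (A :: As) = symmDiff A.toFinset (symmDiffs As) := rfl

namespace DiracSystem

variable {𝕜 : Type*} [RCLike 𝕜] {N : ℕ} {ε : 𝕜} {R : Type*} [Ring R] [Algebra 𝕜 R]
  (s : DiracSystem N ε R)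

theorem eList_cons (a : Fin N) (A : List (Fin N)) : s.eList (a :: A) = s.e a * s.eList A := by
  simp [eList]

theorem eProd_cons (A : List (Fin N)) (As : List (List (Fin N))) :
    s.eProd (A :: As) = s.eList A * s.eProd As := by
  simp [eProd]

theorem eList_mul_comm {A : List (Fin N)} (hA : A.Nodup) {v : R} {f : Fin N → ℤ}
    (hv : ∀ a, s.e a * v = f a • (v * s.e a)) :
    s.eList A * v = (∏ a ∈ A.toFinset, f a) • (v * s.eList A) := by
  induction A with
  | nil => simp [eList]
  | cons a A ih =>
    obtain ⟨ha, hA⟩ := List.nodup_cons.1 hA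
    rw [List.toFinset_cons, Finset.prod_insert (by simpa using ha), eList_cons, mul_assoc, ih hA,
      mul_smul_comm, ← mul_assoc, hv, smul_mul_assoc, smul_smul, mul_comm (f a), mul_assoc]

theorem eProd_mul_comm {As : List (List (Fin N))} (hAs : ∀ A ∈ As, A.Nodup) {v : R}
    {f : Fin N → ℤ} (hf : ∀ a, f a * f a = 1) (hv : ∀ a, s.e a * v = f a • (v * s.e a)) :
    s.eProd As * v = (∏ a ∈ symmDiffs As, f a) • (v * s.eProd As) := by
  induction As with
  | nil => simp [eProd, symmDiffs]
  | cons A As ih =>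
    rw [List.forall_mem_cons] at hAs
    rw [symmDiffs_cons, prod_symmDiff_of_mul_self hf, eProd_cons, mul_assoc, ih hAs.2,
      mul_smul_comm, ← mul_assoc, s.eList_mul_comm hAs.1 hv, smul_mul_assoc, smul_smul,
      mul_comm (∏ a ∈ symmDiffs As, f a), mul_assoc]

theorem e_mul_eProd {As : List (List (Fin N))} (hAs : ∀ A ∈ As, A.Nodup) (b : Fin N) :
    s.e b * s.eProd As = (∏ a ∈ symmDiffs As, eSign a b) • (s.eProd As * s.e b) := by
  rw [s.eProd_mul_comm hAs (fun a => eSign_mul_self a b) (fun a => s.e_mul_e a b), smul_smul,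
    ← Finset.prod_mul_distrib]
  simp [eSign_mul_self]

theorem eProd_mul_eProd {As Bs : List (List (Fin N))} (hAs : ∀ A ∈ As, A.Nodup)
    (hBs : ∀ B ∈ Bs, B.Nodup) :
    s.eProd As * s.eProd Bs = (-1) ^ superExp As Bs * (s.eProd Bs * s.eProd As) := by
  rw [s.eProd_mul_comm hAs (f := fun b => ∏ a ∈ symmDiffs Bs, eSign a b) (fun b => ?_)
    (s.e_mul_eProd hBs), prod_prod_eSign, zsmul_eq_mul, superExp]
  · push_cast; rfl
  · rw [← Finset.prod_mul_distrib]
    exact Finset.prod_eq_one fun a _ => eSign_mul_self a b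

/-- Moving past `v b` costs one sign per index different from `b`: `(-1)^|S|` in total if `b` is
outside the symmetric difference `S`, and one sign fewer if `b` lies in it. -/
theorem eProd_mul_sum {As : List (List (Fin N))} (hAs : ∀ A ∈ As, A.Nodup) {v : Fin N → R}
    (hv : ∀ a b, s.e a * v b = eSign a b • (v b * s.e a)) (T : Finset (Fin N)) :
    s.eProd As * ∑ b ∈ T, v b = (-1 : ℤ) ^ (symmDiffs As).card •
      ((∑ b ∈ T \ symmDiffs As, v b - ∑ b ∈ T ∩ symmDiffs As, v b) * s.eProd As) := by
  rw [← Finset.sum_inter_add_sum_sdiff T (symmDiffs As), mul_add, Finset.mul_sum, Finset.mul_sum,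
    sub_mul, smul_sub, Finset.sum_mul, Finset.sum_mul, Finset.smul_sum, Finset.smul_sum,
    sub_eq_neg_add, ← Finset.sum_neg_distrib]
  congr 1 <;> refine Finset.sum_congr rfl fun b hb => ?_
  · have hb := (Finset.mem_inter.1 hb).2
    rw [s.eProd_mul_comm hAs (fun a => eSign_mul_self a b) (fun a => hv a b), prod_eSign,
      ← Finset.card_erase_add_one hb, pow_succ, mul_neg_one, neg_smul, neg_neg]
  · have hb := (Finset.mem_sdiff.1 hb).2
    rw [s.eProd_mul_comm hAs (fun a => eSign_mul_self a b) (fun a => hv a b), prod_eSign,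
      Finset.erase_eq_of_notMem hb]

theorem eProd_mul_xVec {As : List (List (Fin N))} (hAs : ∀ A ∈ As, A.Nodup)
    (T : Finset (Fin N)) :
    s.eProd As * s.xVec T = (-1 : ℤ) ^ (symmDiffs As).card •
      ((s.xVec (T \ symmDiffs As) - s.xVec (T ∩ symmDiffs As)) * s.eProd As) :=
  s.eProd_mul_sum hAs s.e_mul_xe T

theorem eProd_mul_pVec {As : List (List (Fin N))} (hAs : ∀ A ∈ As, A.Nodup)
    (T : Finset (Fin N)) :
    s.eProd As * s.pVec T = (-1 : ℤ) ^ (symmDiffs As).card •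
      ((s.pVec (T \ symmDiffs As) - s.pVec (T ∩ symmDiffs As)) * s.eProd As) :=
  s.eProd_mul_sum hAs s.e_mul_ep T

theorem eProd_mul_dirac {As : List (List (Fin N))} (hAs : ∀ A ∈ As, A.Nodup) :
    s.eProd As * s.pVec Finset.univ = (-1 : ℤ) ^ (symmDiffs As).card •
      ((s.pVec Finset.univ - 2 * s.pVec (symmDiffs As)) * s.eProd As) := by
  rw [s.eProd_mul_pVec hAs, Finset.univ_inter]
  have h : s.pVec Finset.univ =
      s.pVec (Finset.univ \ symmDiffs As) + s.pVec (symmDiffs As) := by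
    rw [← s.pVec_union Finset.sdiff_disjoint, Finset.sdiff_union_of_subset (Finset.subset_univ _)]
  rw [h]
  congr 2
  noncomm_ring

theorem neg_one_pow_smul_smul (n : ℕ) (v : R) : (-1 : ℤ) ^ n • (-1 : ℤ) ^ n • v = v := by
  rw [smul_smul, ← mul_pow]; simp

/-! ### Normal form and products of the symmetries -/

theorem O_eq {As : List (List (Fin N))} (hAs : ∀ A ∈ As, A.Nodup) :
    s.O As = (1 / 2 : 𝕜) • ((s.form (symmDiffs As) - ε • 1) * s.eProd As) := by
  have h : s.eProd As * s.xVec (symmDiffs As) * s.pVec Finset.univ =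
      -(s.xVec (symmDiffs As) * (s.pVec Finset.univ - 2 * s.pVec (symmDiffs As)) *
        s.eProd As) := by
    rw [s.eProd_mul_xVec hAs, smul_mul_assoc, mul_assoc, s.eProd_mul_dirac hAs, mul_smul_comm,
      neg_one_pow_smul_smul]
    simp [mul_assoc]
  rw [O, h, form, normForm, sub_mul _ (ε • (1 : R)), smul_one_mul]
  congr 2
  noncomm_ring

theorem eProd_mul_form {As : List (List (Fin N))} (hAs : ∀ A ∈ As, A.Nodup)
    (T : Finset (Fin N)) :
    s.eProd As * s.form T = s.formConj (symmDiffs As) T * s.eProd As := by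
  -- `form` is quadratic in the reflected elements, so the global sign `(-1)^|S|` enters twice and
  -- cancels.
  have hc {u v u' v' : R} (hu : s.eProd As * u = (-1 : ℤ) ^ (symmDiffs As).card • (u' * s.eProd As))
      (hv : s.eProd As * v = (-1 : ℤ) ^ (symmDiffs As).card • (v' * s.eProd As)) :
      s.eProd As * (u * v) = u' * v' * s.eProd As := by
    rw [← mul_assoc, hu, smul_mul_assoc, mul_assoc, hv, mul_smul_comm, neg_one_pow_smul_smul,
      mul_assoc]
  have hD := s.eProd_mul_dirac hAs
  have hX := s.eProd_mul_xVec hAs T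
  have hP := s.eProd_mul_pVec hAs T
  rw [form, formConj, normForm, normForm, mul_sub, mul_add, hc hD hX, hc hX hD, 
    show 2 * s.xVec T * s.pVec T = s.xVec T * s.pVec T + s.xVec T * s.pVec T by noncomm_ring,
    mul_add, hc hX hP]
  noncomm_ring

theorem O_mul_O {As Bs : List (List (Fin N))} (hAs : ∀ A ∈ As, A.Nodup)
    (hBs : ∀ B ∈ Bs, B.Nodup) :
    s.O As * s.O Bs = (1 / 4 : 𝕜) • ((s.pairing (symmDiffs As) (symmDiffs Bs)
      - ε • s.form (symmDiff (symmDiffs As) (symmDiffs Bs)) + ε ^ 2 • 1) *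
        (s.eProd As * s.eProd Bs)) := by
  have h : s.eProd As * (s.form (symmDiffs Bs) - ε • 1) =
      (s.formConj (symmDiffs As) (symmDiffs Bs) - ε • 1) * s.eProd As := by
    rw [mul_sub, sub_mul, s.eProd_mul_form hAs, mul_smul_one, smul_one_mul]
  rw [s.O_eq hAs, s.O_eq hBs, smul_mul_smul_comm, mul_assoc, ← mul_assoc (s.eProd As), h,
    mul_assoc _ (s.eProd As), ← mul_assoc]
  congr 2
  · norm_num
  · simp only [pairing, mul_sub, sub_mul, smul_mul_assoc, mul_smul_comm, one_mul, mul_one]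
    module

/-- Reordering the Clifford factors produces the same sign as the prefactor, so the two cancel. Both
orders of the product then differ only in the `pairing` term. -/
theorem O_mul_O_swap {As Bs : List (List (Fin N))} (hAs : ∀ A ∈ As, A.Nodup)
    (hBs : ∀ B ∈ Bs, B.Nodup) :
    (-1) ^ superExp As Bs * (s.O Bs * s.O As) =
      (1 / 4 : 𝕜) • ((s.pairing (symmDiffs Bs) (symmDiffs As)
      - ε • s.form (symmDiff (symmDiffs As) (symmDiffs Bs)) + ε ^ 2 • 1) *
        (s.eProd As * s.eProd Bs)) := by
  rw [s.O_mul_O hBs hAs, s.eProd_mul_eProd hAs hBs, mul_smul_comm, symmDiff_comm]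
  congr 1
  rcases neg_one_pow_eq_or R (superExp As Bs) with h | h <;> simp [h]

/-- The square is a scalar sign. Its exact value plays no role later, since it always meets a second
copy of itself. -/
theorem exists_eList_mul_self (hε : ε ^ 2 = 1) {A : List (Fin N)} (hA : A.Nodup) :
    ∃ c : 𝕜, c ^ 2 = 1 ∧ s.eList A * s.eList A = c • 1 := by
  induction A with
  | nil => exact ⟨1, by simp [eList]⟩
  | cons a A ih =>
    obtain ⟨ha, hA⟩ := List.nodup_cons.1 hA
    obtain ⟨c, hc, h⟩ := ih hA
    have h' : s.eList (a :: A) * s.eList (a :: A) =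
        (-1 : ℤ) ^ (A.toFinset.erase a).card • (ε * c) • (1 : R) := by
      rw [eList_cons, mul_assoc, ← mul_assoc (s.eList A), s.eList_mul_comm hA
        (fun b => s.e_mul_e b a), prod_eSign, smul_mul_assoc, mul_smul_comm, mul_assoc, h,
        ← mul_assoc, e_mul_self, smul_one_mul, smul_smul]
    rcases neg_one_pow_eq_or ℤ (A.toFinset.erase a).card with h1 | h1
    · exact ⟨ε * c, by rw [mul_pow, hε, hc, one_mul], by rw [h', h1, one_smul]⟩
    · exact ⟨-(ε * c), by rw [neg_sq, mul_pow, hε, hc, one_mul], by rw [h', h1]; module⟩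

/-- The supercommutator of `O_a` with `O_{a, L}`, for a sequence `L` of lists. -/
theorem superComm_singleton (a : Fin N) {Ls : List (List (Fin N))}
    (hL : ∀ L ∈ Ls, L.Nodup) {G : Finset (Fin N)} (hG : symmDiffs Ls = G) :
    s.O [[a]] * s.O ([a] :: Ls) - (-1) ^ superExp [[a]] ([a] :: Ls) * (s.O ([a] :: Ls) * s.O [[a]])
      = (ε / 4) • (s.pairingComm G {a} * s.eProd Ls) := by
  have ha : ∀ A ∈ [[a]], A.Nodup := by simp
  have haL : ∀ A ∈ [a] :: Ls, A.Nodup := by simpa using hL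
  have h1 : symmDiffs [[a]] = {a} := by
    rw [symmDiffs_cons]; exact symmDiff_bot _
  have h2 : symmDiffs ([a] :: Ls) = symmDiff {a} G := by
    rw [symmDiffs_cons, hG]; rfl
  have h3 : s.eProd [[a]] * s.eProd ([a] :: Ls) = ε • s.eProd Ls := by
    rw [s.eProd_cons [a] Ls, ← mul_assoc]
    simp [eProd, eList, e_mul_self]
  rw [s.O_mul_O_swap ha haL, s.O_mul_O ha haL, h1, h2, h3, pairingComm]
  simp only [mul_smul_comm, sub_mul, add_mul]
  module

/-! ### Assembly of the identity -/

theorem pairing_add_swap (S T : Finset (Fin N)) :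
    s.pairing S T + s.pairing T S =
      2 • s.pairing (S \ T) (T \ S) + 2 • s.pairing (S ∩ T) (S ∪ T)
        - s.pairingComm (symmDiff S T) (S \ T) - s.pairingComm (symmDiff S T) (S ∩ T) := by
  have h := s.pairing_cross (J := S \ T) (I := S ∩ T) (K := T \ S)
    (by rw [Finset.disjoint_left]; grind) (by rw [Finset.disjoint_left]; grind)
    (by rw [Finset.disjoint_left]; grind)
  have d1 : symmDiff (S \ T) (symmDiff S T) = T \ S := by
    ext; simp only [Finset.mem_symmDiff, Finset.mem_sdiff]; tauto
  have d2 : symmDiff (S ∩ T) (symmDiff S T) = S ∪ T := by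
    ext; simp only [Finset.mem_symmDiff, Finset.mem_inter, Finset.mem_union]; tauto
  rw [show S \ T ∪ S ∩ T = S by grind, show S ∩ T ∪ T \ S = T by grind,
    show S ∪ T \ S = S ∪ T by grind] at h
  rw [pairingComm, pairingComm, d1, d2, h]
  module

theorem superAnti_eq (hε : ε ^ 2 = 1) {A B : List (Fin N)} (hA : A.Nodup) (hB : B.Nodup) :
    s.O [A] * s.O [B] + (-1) ^ superExp [A] [B] * (s.O [B] * s.O [A]) =
      ε • s.O [A, B]
      + s.eList (interList A B) ^ 2 * (2 * (s.O [A, interList A B] * s.O [interList A B, B]))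
      + s.eList (interList A B) ^ 2 * (2 * (s.O [interList A B] * s.O [interList A B, A, B]))
      - ε • (s.eList (interList A B) ^ 2 * ∑ a ∈ A.toFinset \ B.toFinset,
          (s.O [[a]] * s.O [[a], A, interList A B, interList A B, B]
            - (-1) ^ superExp [[a]] [[a], A, interList A B, interList A B, B] *
              (s.O [[a], A, interList A B, interList A B, B] * s.O [[a]])))
      - ε • (s.eList (interList A B) ^ 2 * ∑ a ∈ A.toFinset ∩ B.toFinset,
          (s.O [[a]] * s.O [[a], interList A B, interList A B, A, B]
            - (-1) ^ superExp [[a]] [[a], interList A B, interList A B, A, B] *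
              (s.O [[a], interList A B, interList A B, A, B] * s.O [[a]]))) := by
  have hI : (interList A B).Nodup := hA.filter _
  have hIs : (interList A B).toFinset = A.toFinset ∩ B.toFinset := by
    ext; simp [interList]
  -- Only the underlying set and the absence of repetitions matter, not the order of the common
  -- elements.
  generalize interList A B = I at hI hIs ⊢
  obtain ⟨c, hc, hII⟩ := s.exists_eList_mul_self hε hI
  have hsd (S : List (Fin N)) : symmDiffs [S] = S.toFinset := by
    rw [symmDiffs_cons]; exact symmDiff_bot _
  have hJ' : A.toFinset \ B.toFinset ⊆ symmDiff A.toFinset B.toFinset := by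
    intro a; simp only [Finset.mem_symmDiff]; grind
  have hI' : Disjoint (A.toFinset ∩ B.toFinset) (symmDiff A.toFinset B.toFinset) := by
    rw [Finset.disjoint_left]; simp only [Finset.mem_symmDiff]; grind
  rw [Finset.sum_congr rfl fun a _ => s.superComm_singleton a (Ls := [A, I, I, B]) (by simp [*])
      (G := symmDiff A.toFinset B.toFinset) (by simp [symmDiffs_cons, hsd]),
    Finset.sum_congr rfl fun a _ => s.superComm_singleton a (Ls := [I, I, A, B]) (by simp [*])
      (G := symmDiff A.toFinset B.toFinset) (by simp [symmDiffs_cons, hsd]),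
    ← Finset.smul_sum, ← Finset.smul_sum, ← Finset.sum_mul, ← Finset.sum_mul,
    s.sum_pairingComm_of_subset hJ', s.sum_pairingComm_of_disjoint hI',
    s.O_mul_O (by simp [*]) (by simp [*]), s.O_mul_O_swap (by simp [*]) (by simp [*]),
    s.O_mul_O (As := [A, I]) (by simp [*]) (by simp [*]),
    s.O_mul_O (As := [I]) (by simp [*]) (by simp [*]), s.O_eq (As := [A, B]) (by simp [*])]
  -- Every Clifford factor is `e_A e_B`, or `c` times it where a pair of copies of `I` collapses;
  -- the prefactor `e_I ^ 2 = c` then gives `c ^ 2 = 1`.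
  have e1 : s.eProd [A] * s.eProd [B] = s.eList A * s.eList B := by simp [eProd]
  have e2 : s.eProd [A, I] * s.eProd [I, B] = c • (s.eList A * s.eList B) := by
    simp only [eProd, List.map_cons, List.map_nil, List.prod_cons, List.prod_nil, mul_one]
    rw [mul_assoc, ← mul_assoc (s.eList I), hII, smul_one_mul, mul_smul_comm]
  have e3 : s.eProd [I] * s.eProd [I, A, B] = c • (s.eList A * s.eList B) := by
    simp only [eProd, List.map_cons, List.map_nil, List.prod_cons, List.prod_nil, mul_one]
    rw [← mul_assoc, hII, smul_one_mul]
  have e4 : s.eProd [A, I, I, B] = c • (s.eList A * s.eList B) := by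
    simp only [eProd, List.map_cons, List.map_nil, List.prod_cons, List.prod_nil, mul_one]
    rw [← mul_assoc (s.eList I), hII, smul_one_mul, mul_smul_comm]
  have e5 : s.eProd [I, I, A, B] = c • (s.eList A * s.eList B) := by
    simp only [eProd, List.map_cons, List.map_nil, List.prod_cons, List.prod_nil, mul_one]
    rw [← mul_assoc, hII, smul_one_mul]
  have e6 : s.eProd [A, B] = s.eList A * s.eList B := by simp [eProd]
  rw [e1, e2, e3, e4, e5, e6, pow_two (s.eList I), hII]
  have d1 : symmDiffs [A, I] = A.toFinset \ B.toFinset := by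
    ext; simp only [symmDiffs_cons, hsd, hIs, Finset.mem_symmDiff, Finset.mem_inter,
      Finset.mem_sdiff]; tauto
  have d2 : symmDiffs [I, B] = B.toFinset \ A.toFinset := by
    ext; simp only [symmDiffs_cons, hsd, hIs, Finset.mem_symmDiff, Finset.mem_inter,
      Finset.mem_sdiff]; tauto
  have d3 : symmDiffs [I, A, B] = A.toFinset ∪ B.toFinset := by
    ext; simp only [symmDiffs_cons, hsd, hIs, Finset.mem_symmDiff, Finset.mem_inter,
      Finset.mem_union]; tauto
  have d4 : symmDiffs [A, B] = symmDiff A.toFinset B.toFinset := by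
    rw [symmDiffs_cons, hsd]
  have d5 : symmDiff (A.toFinset \ B.toFinset) (B.toFinset \ A.toFinset) =
      symmDiff A.toFinset B.toFinset := by
    ext; simp only [Finset.mem_symmDiff, Finset.mem_sdiff]; tauto
  have d6 : symmDiff (A.toFinset ∩ B.toFinset) (A.toFinset ∪ B.toFinset) =
      symmDiff A.toFinset B.toFinset := by
    ext; simp only [Finset.mem_symmDiff, Finset.mem_inter, Finset.mem_union]; tauto
  have key := congrArg (· * (s.eList A * s.eList B))
    (s.pairing_add_swap A.toFinset B.toFinset)
  simp only [hsd, d1, d2, d3, d4, d5, d6, hIs]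
  clear * - key hε hc
  simp only [mul_smul_comm, smul_mul_assoc, one_mul, two_mul, add_mul, sub_mul, smul_smul]
    at key ⊢
  -- With both signs numeric, the claim is linear in the pairings. The factor 1/4 is the one from
  -- `O_mul_O`.
  rcases sq_eq_one_iff.1 hε with rfl | rfl <;> rcases sq_eq_one_iff.1 hc with rfl | rfl <;>
    linear_combination (norm := module) (1 / 4 : 𝕜) • key

end DiracSystem

end DiracSymm

theorem mainTheorem4 {𝕜 : Type*} [RCLike 𝕜] (N : ℕ) (ε : 𝕜) (hε : ε = 1 ∨ ε = -1)
    (A B : List (Fin N)) (hA : A.Nodup) (hB : B.Nodup) :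
    DiracSymm.superAnti ε [A] [B] =
      ε • DiracSymm.O ε [A, B]
      + DiracSymm.eList ε (DiracSymm.interList A B) ^ 2 *
          (2 * (DiracSymm.O ε [A, DiracSymm.interList A B] *
            DiracSymm.O ε [DiracSymm.interList A B, B]))
      + DiracSymm.eList ε (DiracSymm.interList A B) ^ 2 *
          (2 * (DiracSymm.O ε [DiracSymm.interList A B] *
            DiracSymm.O ε [DiracSymm.interList A B, A, B]))
      - ε • (DiracSymm.eList ε (DiracSymm.interList A B) ^ 2 *
          ∑ a ∈ A.toFinset \ B.toFinset,
            DiracSymm.superComm ε [[a]]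
              [[a], A, DiracSymm.interList A B, DiracSymm.interList A B, B])
      - ε • (DiracSymm.eList ε (DiracSymm.interList A B) ^ 2 *
          ∑ a ∈ A.toFinset ∩ B.toFinset,
            DiracSymm.superComm ε [[a]]
              [[a], DiracSymm.interList A B, DiracSymm.interList A B, A, B]) :=
  -- The operators of `genSystem` unfold definitionally to those of the statement.
  (DiracSymm.genSystem N ε).superAnti_eq (by rcases hε with rfl | rfl <;> norm_num) hA hB
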